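/- Bodyguards and Presidents is played on a graph $G$. First $b$ bodyguard tokens are placed on vertices, then one president token is placed on a vertex; several tokens may share a vertex. Then the bodyguards and the president alternate turns, the bodyguards going first. In a turn, each token of the player may move to an adjacent vertex or stay where it is. The bodyguards win if, at the end of all but finitely many of their turns, every vertex in the open neighbourhood of the president's position is occupied by a bodyguard. The bodyguard number $B(G)$ is the least $b$ such that $b$ bodyguards have a winning strategy on $G$. Let $P_n$ denote the path on $n$ vertices and $\square$ the Cartesian product of graphs. Theorem. If $n_1,\dots,n_k\ge 2$, then $$B\left(\square_{i=1}^k P_{n_i}\right)\le\left\lfloor\frac{5k}{2}\right\rfloor .$$ -/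

import Mathlib

namespace SimpleGraph

/-- The Cartesian product of a family of graphs: two vertices are adjacent when they are adjacent
in one coordinate and agree in all the others. -/
def cartesianProduct {ι : Type*} {V : ι → Type*} (G : ∀ i, SimpleGraph (V i)) :
    SimpleGraph (∀ i, V i) where
  Adj x y := ∃ i, (G i).Adj (x i) (y i) ∧ ∀ j, j ≠ i → x j = y j
  symm := ⟨fun _ _ ⟨i, h, h'⟩ => ⟨i, h.symm, fun j hj => (h' j hj).symm⟩⟩
  loopless := ⟨fun _ ⟨i, h, _⟩ => (G i).loopless.irrefl _ h⟩

/-- The Cartesian grid with side lengths `n 0, …, n (k - 1)`: the Cartesian product of paths on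
`n i` vertices each. -/
def cartesianGrid {k : ℕ} (n : Fin k → ℕ) : SimpleGraph (∀ i, Fin (n i)) :=
  cartesianProduct fun i => pathGraph (n i)

/-- What a single token may do in one turn: stay put or move to an adjacent vertex. -/
def IsTokenMove {V : Type*} (G : SimpleGraph V) (u v : V) : Prop :=
  u = v ∨ G.Adj u v

/-- A legal sequence of positions of the president: he is placed on `p 0`, and on his
`(t + 1)`-st turn he goes from `p t` to `p (t + 1)`. -/
def IsPresidentPlay {V : Type*} (G : SimpleGraph V) (p : ℕ → V) : Prop :=
  ∀ t, G.IsTokenMove (p t) (p (t + 1))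

/-- A strategy for `b` bodyguards: it assigns to every finite history of president positions
(oldest first) the positions of the bodyguards. The value at the empty history is the initial
placement, which is made before the president is placed. -/
abbrev BodyguardStrategy (V : Type*) (b : ℕ) : Type _ :=
  List V → Fin b → V

/-- The positions of the bodyguards after `t` of their turns, when they follow `σ` and the
president plays `p`. The rounds are: the bodyguards are placed (`t = 0`), the president is placed
on `p 0`, the bodyguards take a turn knowing `p 0`, the president moves to `p 1`, the bodyguards
take a turn knowing `p 0` and `p 1`, and so on. -/
def BodyguardStrategy.positions {V : Type*} {b : ℕ} (σ : BodyguardStrategy V b)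
    (p : ℕ → V) (t : ℕ) : Fin b → V :=
  σ ((List.range t).map p)

/-- The president on `v` is surrounded: every vertex in the open neighbourhood of `v` is occupied
by a bodyguard. -/
def IsSurrounded {V : Type*} (G : SimpleGraph V) {b : ℕ} (c : Fin b → V) (v : V) : Prop :=
  ∀ w, G.Adj v w → ∃ i, c i = w

/-- The strategy `σ` is a winning one: against every play of the president, it makes only legal
moves, and the president is surrounded at the end of all but finitely many bodyguard turns
(after turn number `t + 1` of the bodyguards the president is on `p t`). -/
def IsWinningStrategy {V : Type*} (G : SimpleGraph V) {b : ℕ} (σ : BodyguardStrategy V b) : Prop :=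
  ∀ p : ℕ → V, G.IsPresidentPlay p →
    (∀ t i, G.IsTokenMove (σ.positions p t i) (σ.positions p (t + 1) i)) ∧
    ∃ T, ∀ t, T ≤ t → G.IsSurrounded (σ.positions p (t + 1)) (p t)

/-- `b` bodyguards suffice to win Bodyguards and Presidents on `G`. -/
def BodyguardsWin {V : Type*} (G : SimpleGraph V) (b : ℕ) : Prop :=
  ∃ σ : BodyguardStrategy V b, G.IsWinningStrategy σ

/-- The bodyguard number: the fewest number of bodyguards that suffice to win on `G`
(`⊤` if no finite number suffices). -/
noncomputable def bodyguardNumber {V : Type*} (G : SimpleGraph V) : ℕ∞ :=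
  ⨅ b : {b : ℕ // G.BodyguardsWin b}, ((b : ℕ) : ℕ∞)

end SimpleGraph

/-! For each of the `2 * k` directions, the shift by one step (standing still at the boundary)
carries token moves to token moves, and every neighbour of a vertex is one of its shifts. A
bodyguard on a shift of the president can stay on it forever, and once all shifts are held the
president is surrounded. A shift not yet held moves like an evader, so the free bodyguards can chase
it while the others keep theirs (`WinsFrom.of_shadows_succ`). If `k / 2 + 1` pursuers catch an
evader, `2 * k + k / 2` bodyguards are enough: that many pursuers are still free when only one shift
is missing.

In the pursuit, one pursuer is in charge of coordinate `0` and of passes, each other one of a pair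
of coordinates. Each has a well-founded measure that never rises and that drops when the evader
makes a turn in this pursuer's charge. Every turn is in somebody's charge, so the vector of measures
falls until a capture. One token can handle two coordinates because it keeps its distance to the
evader even. -/

namespace SimpleGraph

/-! ### Reduction of the game to a pursuit -/

section Game

variable {V : Type*} {G : SimpleGraph V} {b : ℕ}

/-- From the position in which the bodyguards stand on `c`, the president stands on `v` and it is
the president's turn, the bodyguards can force that the president is eventually always
surrounded. -/
def WinsFrom (G : SimpleGraph V) {b : ℕ} (c : Fin b → V) (v : V) : Prop :=
  ∃ τ : BodyguardStrategy V b, τ [] = c ∧ ∀ q : ℕ → V, G.IsPresidentPlay q → q 0 = v →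
    (∀ t i, G.IsTokenMove (τ.positions (fun s => q (s + 1)) t i)
      (τ.positions (fun s => q (s + 1)) (t + 1) i)) ∧
    ∃ T, ∀ t, T ≤ t → G.IsSurrounded (τ.positions (fun s => q (s + 1)) t) (q t)

theorem BodyguardStrategy.positions_succ (σ : BodyguardStrategy V b) (p : ℕ → V) (t : ℕ) :
    σ.positions p (t + 1) =
      BodyguardStrategy.positions (fun h => σ (p 0 :: h)) (fun s => p (s + 1)) t := by
  simp [BodyguardStrategy.positions, List.range_succ_eq_map, Function.comp_def]

theorem WinsFrom.of_forall_move {c : Fin b → V} {v : V}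
    (h : ∀ w, G.IsTokenMove v w →
      ∃ c' : Fin b → V, (∀ i, G.IsTokenMove (c i) (c' i)) ∧ G.WinsFrom c' w) :
    G.WinsFrom c v := by
  classical
  choose! next hmove τ hnil hτ using h
  refine ⟨fun l => match l with
    | [] => c
    | w :: l => τ w l, rfl, fun q hq hq0 => ?_⟩
  have hv : G.IsTokenMove v (q 1) := hq0 ▸ hq 0
  obtain ⟨hlegal, T, hT⟩ := hτ (q 1) hv (fun s => q (s + 1)) (fun t => hq (t + 1)) rfl
  refine ⟨fun t i => ?_, T + 1, fun t ht => ?_⟩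
  · rcases t with _ | t
    · have := hmove (q 1) hv i
      rw [BodyguardStrategy.positions_succ]
      simpa [BodyguardStrategy.positions, hnil (q 1) hv] using this
    · rw [BodyguardStrategy.positions_succ, BodyguardStrategy.positions_succ]
      exact hlegal t i
  · obtain ⟨t, rfl⟩ : ∃ s, t = s + 1 := ⟨t - 1, by omega⟩
    rw [BodyguardStrategy.positions_succ]
    exact hT t (by omega)

theorem bodyguardsWin_of_forall_winsFrom (c : Fin b → V) (h : ∀ v, G.WinsFrom c v) :
    G.BodyguardsWin b := by
  choose τ hnil hτ using h
  refine ⟨fun l => match l with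
    | [] => c
    | w :: l => τ w l, fun p hp => ?_⟩
  obtain ⟨hlegal, T, hT⟩ := hτ (p 0) p hp rfl
  refine ⟨fun t i => ?_, T, fun t ht => ?_⟩
  · rcases t with _ | t
    · rw [BodyguardStrategy.positions_succ]
      exact Or.inl (by simp [BodyguardStrategy.positions, hnil])
    · rw [BodyguardStrategy.positions_succ, BodyguardStrategy.positions_succ]
      exact hlegal t i
  · rw [BodyguardStrategy.positions_succ]
    exact hT t ht

/-- Up to relabelling the bodyguards by `π`, the first `l` of them stand on the images of `v` under
the first `l` maps `f i`. -/
def Shadows (f : ℕ → V → V) (l : ℕ) (π : Equiv.Perm (Fin b)) (c : Fin b → V) (v : V) : Prop :=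
  ∀ i : Fin b, i.val < l → c (π i) = f i v

theorem WinsFrom.of_shadows {f : ℕ → V → V} {N : ℕ} (hN : N ≤ b)
    (hf : ∀ i v w, G.IsTokenMove v w → G.IsTokenMove (f i v) (f i w))
    (hcover : ∀ v w, G.Adj v w → ∃ i < N, f i v = w)
    {π : Equiv.Perm (Fin b)} {c : Fin b → V} {v : V} (h : Shadows f N π c v) :
    G.WinsFrom c v := by
  let τ : BodyguardStrategy V b := fun l i =>
    -- The default `v` serves the empty history, when the president has not yet left `v`.
    if (π.symm i).val < N then f (π.symm i) (l.getLastD v) else c i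
  have hpos : ∀ q : ℕ → V, q 0 = v → ∀ t i, τ.positions (fun s => q (s + 1)) t i =
      if (π.symm i).val < N then f (π.symm i) (q t) else c i := by
    intro q hq t i
    rcases t with _ | t
    · simp [BodyguardStrategy.positions, τ, hq]
    · simp [BodyguardStrategy.positions, τ, List.range_succ, List.getLastD_eq_getLast?]
  refine ⟨τ, ?_, fun q hq hq0 => ⟨fun t i => ?_, 0, fun t _ w hw => ?_⟩⟩
  · funext i
    have := h (π.symm i)
    by_cases hi : (π.symm i).val < N
    · simpa [τ, hi] using (this hi).symm
    · simp [τ, hi]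
  · rw [hpos q hq0, hpos q hq0]
    split_ifs
    · exact hf _ _ _ (hq t)
    · exact Or.inl rfl
  · obtain ⟨i, hi, hiw⟩ := hcover _ _ hw
    refine ⟨π ⟨i, by omega⟩, ?_⟩
    rw [hpos q hq0]
    simpa [hi] using hiw

/-- A measure witnessing that `m` pursuers catch an evader on `G`: as long as no pursuer has caught
the evader, they can answer each of his moves in such a way that the measure decreases. -/
def IsPursuit (G : SimpleGraph V) {m : ℕ} {α : Type*} [Preorder α]
    (μ : Fin m → V → V → α) : Prop :=
  ∀ (c : Fin m → V) (r r' : V), G.IsTokenMove r r' → (∀ j, c j ≠ r) →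
    ∃ c' : Fin m → V, (∀ j, G.IsTokenMove (c j) (c' j)) ∧
      (fun j => μ j (c' j) r') < fun j => μ j (c j) r

/-- The bodyguards labelled `l, …, l + m - 1` chase the token `f l v` while the first `l` follow
their own images. Well-founded induction on the vector of measures forces a capture. -/
theorem WinsFrom.of_shadows_succ {α : Type*} [Preorder α] [WellFoundedLT α] {m : ℕ}
    {μ : Fin m → V → V → α} (hμ : G.IsPursuit μ) {f : ℕ → V → V} {l : ℕ}
    (hf : ∀ i v w, G.IsTokenMove v w → G.IsTokenMove (f i v) (f i w)) (hl : l + m ≤ b)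
    (ih : ∀ (π : Equiv.Perm (Fin b)) (c : Fin b → V) (v : V),
      Shadows f (l + 1) π c v → G.WinsFrom c v)
    (π : Equiv.Perm (Fin b)) (c : Fin b → V) (v : V) (h : Shadows f l π c v) :
    G.WinsFrom c v := by
  let team : Fin m → Fin b := fun j => ⟨l + j, by omega⟩
  obtain ⟨x, hx⟩ : ∃ x : Fin m → α, x = fun j => μ j (c (π (team j))) (f l v) := ⟨_, rfl⟩
  induction x using WellFoundedLT.induction generalizing c v with
  | ind x IH =>
  by_cases hcatch : ∃ j, c (π (team j)) = f l v
  · obtain ⟨j, hj⟩ := hcatch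
    have hlb : l < b := by have := j.isLt; omega
    -- The captor takes over label `l`; the labels below `l` are untouched.
    refine ih ((Equiv.swap ⟨l, hlb⟩ (team j)).trans π) c v fun i hi => ?_
    rcases Nat.lt_succ_iff_lt_or_eq.mp hi with hi | hi
    · rw [Equiv.trans_apply, Equiv.swap_apply_of_ne_of_ne, h i hi]
      · rintro rfl
        simp at hi
      · rintro rfl
        simp [team] at hi
    · obtain rfl : i = ⟨l, hlb⟩ := Fin.ext hi
      rw [Equiv.trans_apply, Equiv.swap_apply_left, hj]
  · push Not at hcatch
    refine WinsFrom.of_forall_move fun w hw => ?_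
    obtain ⟨e, he, hlt⟩ := hμ (fun j => c (π (team j))) (f l v) (f l w) (hf l v w hw) hcatch
    let g : Fin b → V := fun i =>
      if i.val < l then f i w
      else if hi : i.val - l < m then e ⟨i.val - l, hi⟩ else c (π i)
    have hteam : ∀ j, g (team j) = e j := fun j => by simp [g, team]
    refine ⟨fun i => g (π.symm i), fun i => ?_, ?_⟩
    · obtain ⟨i, rfl⟩ := π.surjective i
      simp only [Equiv.symm_apply_apply]
      by_cases h1 : i.val < l
      · simpa [g, h1, h i h1] using hf i v w hw
      · by_cases h2 : i.val - l < m
        · have h3 : team ⟨i.val - l, h2⟩ = i := Fin.ext (by simp [team]; omega)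
          have := he ⟨i.val - l, h2⟩
          rw [← hteam, h3] at this
          exact this
        · exact Or.inl (by simp [g, h1, h2])
    · refine IH _ ?_ (fun i => g (π.symm i)) w (fun i hi => by simp [g, hi]) rfl
      subst hx
      simpa [hteam] using hlt

/-- If `m + 1` pursuers can catch an evader, and the neighbourhood of each vertex is covered by its
images under `N` maps that respect token moves, then `N + m` bodyguards win. -/
theorem bodyguardsWin_of_isPursuit {α : Type*} [Preorder α] [WellFoundedLT α] [Nonempty V]
    {m N : ℕ} {μ : Fin (m + 1) → V → V → α} (hμ : G.IsPursuit μ) (f : ℕ → V → V)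
    (hf : ∀ i v w, G.IsTokenMove v w → G.IsTokenMove (f i v) (f i w))
    (hcover : ∀ v w, G.Adj v w → ∃ i < N, f i v = w) :
    G.BodyguardsWin (N + m) := by
  have key : ∀ d l, l + d = N → ∀ (π : Equiv.Perm (Fin (N + m))) (c : Fin (N + m) → V) (v : V),
      Shadows f l π c v → G.WinsFrom c v := by
    intro d
    induction d with
    | zero =>
      rintro l rfl π c v h
      exact WinsFrom.of_shadows (by omega) hf hcover h
    | succ d ih =>
      intro l hl
      -- Here `l < N`, so at least `m + 1` bodyguards are free.
      exact WinsFrom.of_shadows_succ hμ hf (by omega) (ih (l + 1) (by omega))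
  exact bodyguardsWin_of_forall_winsFrom (fun _ => Classical.arbitrary V) fun v =>
    key N 0 (by omega) 1 _ v fun i hi => absurd hi (by omega)

end Game

/-! ### Coordinate distances, approaching and following -/

section Grid

variable {k : ℕ} {n : Fin k → ℕ}

theorem cartesianGrid_isTokenMove_update {r : ∀ i, Fin (n i)} {i : Fin k} {v : Fin (n i)}
    (h : r i = v ∨ (r i).val + 1 = v ∨ v.val + 1 = r i) :
    (cartesianGrid n).IsTokenMove r (Function.update r i v) := by
  rcases h with h | h
  · left
    rw [← h, Function.update_eq_self]
  · right
    refine ⟨i, ?_, fun j hj => by simp [hj]⟩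
    rw [pathGraph_adj]
    simpa using h

theorem cartesianGrid_isTokenMove_cases {r r' : ∀ i, Fin (n i)}
    (h : (cartesianGrid n).IsTokenMove r r') :
    r = r' ∨ ∃ i, ((r i).val + 1 = r' i ∨ (r' i).val + 1 = r i) ∧ ∀ j, j ≠ i → r' j = r j := by
  rcases h with h | ⟨i, hi, h⟩
  · exact Or.inl h
  · exact Or.inr ⟨i, pathGraph_adj.mp hi, fun j hj => (h j hj).symm⟩

/-- The distance between `c` and `r` in coordinate `i`. -/
def gap (c r : ∀ i, Fin (n i)) (i : Fin k) : ℕ :=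
  ((c i).val - r i) + ((r i).val - c i)

/-- A bound for the number of times that an evader on `r` can move away in coordinate `i` from a
pursuer on `c` who follows him; it is zero if the two agree in this coordinate. -/
def wall (c r : ∀ i, Fin (n i)) (i : Fin k) : ℕ :=
  if (c i).val < r i then n i - r i else if (r i).val < c i then r i + 1 else 0

theorem gap_eq_zero {c r : ∀ i, Fin (n i)} {i : Fin k} : gap c r i = 0 ↔ c i = r i := by
  rw [gap, Fin.ext_iff]
  omega

theorem gap_congr {c c' r r' : ∀ i, Fin (n i)} {i : Fin k} (hc : c' i = c i) (hr : r' i = r i) :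
    gap c' r' i = gap c r i := by
  simp [gap, hc, hr]

theorem wall_congr {c c' r r' : ∀ i, Fin (n i)} {i : Fin k} (hc : c' i = c i) (hr : r' i = r i) :
    wall c' r' i = wall c r i := by
  simp [wall, hc, hr]

theorem sum_gap_congr {c c' r r' : ∀ i, Fin (n i)} (h : ∀ j, gap c' r' j = gap c r j)
    (S : Finset (Fin k)) : ∑ j ∈ S, gap c' r' j = ∑ j ∈ S, gap c r j :=
  Finset.sum_congr rfl fun j _ => h j

theorem exists_gap_pos {c r : ∀ i, Fin (n i)} (h : c ≠ r) : ∃ i, 0 < gap c r i := by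
  by_contra! H
  exact h (funext fun i => gap_eq_zero.mp (Nat.le_zero.mp (H i)))

theorem exists_approach {c r : ∀ i, Fin (n i)} {i : Fin k} (h : 0 < gap c r i) :
    ∃ c', (cartesianGrid n).IsTokenMove c c' ∧ (∀ j, j ≠ i → c' j = c j) ∧
      gap c' r i + 1 = gap c r i ∧
      (((c i).val < r i ∧ (c' i).val = c i + 1) ∨ ((r i).val < c i ∧ (c' i).val + 1 = c i)) := by
  rcases lt_trichotomy (c i).val (r i) with hlt | heq | hlt
  · refine ⟨Function.update c i ⟨c i + 1, by omega⟩,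
      cartesianGrid_isTokenMove_update (by simp), fun j hj => by simp [hj], ?_, ?_⟩
    · simp only [gap, Function.update_self]
      omega
    · simp [hlt]
  · simp [gap, heq] at h
  · refine ⟨Function.update c i ⟨c i - 1, by omega⟩,
      cartesianGrid_isTokenMove_update (by simp; omega), fun j hj => by simp [hj], ?_, ?_⟩
    · simp only [gap, Function.update_self]
      omega
    · simp
      omega

theorem gap_of_move {c r r' : ∀ i, Fin (n i)} {i : Fin k}
    (h : (r i).val + 1 = r' i ∨ (r' i).val + 1 = r i) :
    gap c r' i = gap c r i + 1 ∨ gap c r' i + 1 = gap c r i := by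
  unfold gap
  omega

/-- If the evader moves away in coordinate `i`, then the pursuer can follow him. -/
theorem exists_follow {c r r' : ∀ i, Fin (n i)} {i : Fin k}
    (h : (r i).val + 1 = r' i ∨ (r' i).val + 1 = r i) (hr : ∀ j, j ≠ i → r' j = r j)
    (hgap : gap c r' i = gap c r i + 1) :
    ∃ c', (cartesianGrid n).IsTokenMove c c' ∧ (∀ j, gap c' r' j = gap c r j) ∧
      ∑ j, wall c' r' j ≤ ∑ j, wall c r j ∧
      (0 < gap c r i → ∑ j, wall c' r' j < ∑ j, wall c r j) := by
  obtain ⟨c', hmove, hc, hg, hdir⟩ := exists_approach (c := c) (r := r') (i := i) (by omega)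
  -- A fleeing evader stays on the same side of the pursuer and gets one step closer to the end of
  -- the path; if the two agreed in `i`, they agree again.
  have hle : wall c' r' i ≤ wall c r i := by
    have h1 := (r i).isLt
    have h2 := (r' i).isLt
    unfold gap at *
    unfold wall
    split_ifs <;> omega
  have hlt : 0 < gap c r i → wall c' r' i < wall c r i := by
    have h1 := (r i).isLt
    have h2 := (r' i).isLt
    unfold gap at *
    unfold wall
    split_ifs <;> omega
  have hall : ∀ j, wall c' r' j ≤ wall c r j := fun j => by
    by_cases hj : j = i
    · exact hj ▸ hle
    · exact (wall_congr (hc j hj) (hr j hj)).le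
  refine ⟨c', hmove, fun j => ?_, Finset.sum_le_sum fun j _ => hall j, fun hpos =>
    Finset.sum_lt_sum (fun j _ => hall j) ⟨i, Finset.mem_univ i, hlt hpos⟩⟩
  by_cases hj : j = i
  · subst hj
    omega
  · exact gap_congr (hc j hj) (hr j hj)

theorem sum_add_eq_of_eq_off {ι : Type*} [DecidableEq ι] {S : Finset ι} {d d' : ι → ℕ} {i : ι}
    (h : ∀ j, j ≠ i → d' j = d j) (hi : i ∈ S) :
    ∑ j ∈ S, d' j + d i = ∑ j ∈ S, d j + d' i := by
  have : ∑ j ∈ S.erase i, d' j = ∑ j ∈ S.erase i, d j :=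
    Finset.sum_congr rfl fun j hj => h j (Finset.ne_of_mem_erase hj)
  rw [← Finset.add_sum_erase S d' hi, ← Finset.add_sum_erase S d hi]
  omega

theorem sum_eq_of_eq_off {ι : Type*} {S : Finset ι} {d d' : ι → ℕ} {i : ι}
    (h : ∀ j, j ≠ i → d' j = d j) (hi : i ∉ S) : ∑ j ∈ S, d' j = ∑ j ∈ S, d j :=
  Finset.sum_congr rfl fun j hj => h j fun hji => hi (hji ▸ hj)

theorem exists_gap_pos_of_sum_pos {S : Finset (Fin k)} {c r : ∀ i, Fin (n i)}
    (h : 0 < ∑ j ∈ S, gap c r j) : ∃ i ∈ S, 0 < gap c r i := by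
  obtain ⟨i, hi, hne⟩ := Finset.exists_ne_zero_of_sum_ne_zero h.ne'
  exact ⟨i, hi, Nat.pos_of_ne_zero hne⟩

/-! ### The pursuer in charge of one coordinate and of passes -/

/-- Quadruples of natural numbers in the lexicographic order. -/
def quad (e d m w : ℕ) : ℕ ×ₗ ℕ ×ₗ ℕ ×ₗ ℕ :=
  toLex (e, toLex (d, toLex (m, w)))

theorem quad_lt {e d m w e' d' m' w' : ℕ} : quad e d m w < quad e' d' m' w' ↔
    e < e' ∨ e = e' ∧ (d < d' ∨ d = d' ∧ (m < m' ∨ m = m' ∧ w < w')) := by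
  simp [quad, Prod.Lex.toLex_lt_toLex]

theorem quad_le {e d m w e' d' m' w' : ℕ} : quad e d m w ≤ quad e' d' m' w' ↔
    e < e' ∨ e = e' ∧ (d < d' ∨ d = d' ∧ (m < m' ∨ m = m' ∧ w ≤ w')) := by
  simp [quad, Prod.Lex.toLex_le_toLex]

/-- The measure of a pursuer on `c` who is in charge of the coordinate `x` and of the turns in
which the evader on `r` does not move. -/
def axisMeasure (x : Fin k) (c r : ∀ i, Fin (n i)) : WithTop (ℕ ×ₗ ℕ ×ₗ ℕ ×ₗ ℕ) :=
  (quad (∑ i ∈ {x}ᶜ, gap c r i) (gap c r x) 0 (∑ i, wall c r i) : ℕ ×ₗ ℕ ×ₗ ℕ ×ₗ ℕ)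

/-- A turn in charge is spent on closing a gap off `x`, if there is one. Otherwise the two differ
only in `x`: a pass lets the pursuer approach, a step towards him closes the gap, and a step away is
followed at the expense of `wall`. Off `x`, retreats are followed and advances are awaited. -/
theorem exists_axisMeasure_le (x : Fin k) {c r r' : ∀ i, Fin (n i)} (hcr : c ≠ r)
    (h : (cartesianGrid n).IsTokenMove r r') :
    ∃ c', (cartesianGrid n).IsTokenMove c c' ∧ axisMeasure x c' r' ≤ axisMeasure x c r ∧
      (r = r' ∨ r x ≠ r' x → axisMeasure x c' r' < axisMeasure x c r) := by
  have hx : x ∉ ({x}ᶜ : Finset (Fin k)) := by simp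
  simp only [axisMeasure, WithTop.coe_le_coe, WithTop.coe_lt_coe, quad_lt, quad_le, lt_irrefl,
    true_and, false_or]
  rcases cartesianGrid_isTokenMove_cases h with rfl | ⟨i, hi, hr⟩
  · rcases Nat.eq_zero_or_pos (∑ i ∈ {x}ᶜ, gap c r i) with hE | hE
    · have hxpos : 0 < gap c r x := by
        obtain ⟨j, hj⟩ := exists_gap_pos hcr
        by_cases hjx : j = x
        · exact hjx ▸ hj
        · have := Finset.sum_eq_zero_iff.mp hE j (by simp [hjx])
          omega
      obtain ⟨c', hmove, hc, hg, -⟩ := exists_approach hxpos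
      have := sum_eq_of_eq_off (d := gap c r) (d' := gap c' r)
        (fun j hj => gap_congr (hc j hj) rfl) hx
      exact ⟨c', hmove, by omega, by omega⟩
    · obtain ⟨l, hl, hpos⟩ := exists_gap_pos_of_sum_pos hE
      obtain ⟨c', hmove, hc, hg, -⟩ := exists_approach hpos
      have := sum_add_eq_of_eq_off (d := gap c r) (d' := gap c' r)
        (fun j hj => gap_congr (hc j hj) rfl) hl
      exact ⟨c', hmove, by omega, by omega⟩
  · have hne : ¬ r = r' := by
      rintro rfl
      omega
    have hr' : ∀ j, j ≠ i → gap c r' j = gap c r j := fun j hj => gap_congr rfl (hr j hj)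
    by_cases hix : i = x
    · subst hix
      have hsum := sum_eq_of_eq_off hr' hx
      rcases Nat.eq_zero_or_pos (∑ j ∈ {i}ᶜ, gap c r j) with hE | hE
      · have hipos : 0 < gap c r i := by
          obtain ⟨j, hj⟩ := exists_gap_pos hcr
          by_cases hji : j = i
          · exact hji ▸ hj
          · have := Finset.sum_eq_zero_iff.mp hE j (by simp [hji])
            omega
        rcases gap_of_move (c := c) hi with hg | hg
        · obtain ⟨c', hmove, hgap, -, hw⟩ := exists_follow hi hr hg
          have := hw hipos
          have h1 := sum_gap_congr hgap {i}ᶜ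
          have h2 := hgap i
          exact ⟨c', hmove, by omega, by omega⟩
        · exact ⟨c, Or.inl rfl, by omega, by omega⟩
      · obtain ⟨l, hl, hpos⟩ := exists_gap_pos_of_sum_pos (hsum ▸ hE)
        obtain ⟨c', hmove, hc, hg, -⟩ := exists_approach hpos
        have := sum_add_eq_of_eq_off (d := gap c r') (d' := gap c' r')
          (fun j hj => gap_congr (hc j hj) rfl) hl
        exact ⟨c', hmove, by omega, by omega⟩
    · have hrx : ¬ (r = r' ∨ r x ≠ r' x) := by simp [hne, hr x (Ne.symm hix)]
      rcases gap_of_move (c := c) hi with hg | hg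
      · obtain ⟨c', hmove, hgap, hw, -⟩ := exists_follow hi hr hg
        have h1 := sum_gap_congr hgap {x}ᶜ
        have h2 := hgap x
        exact ⟨c', hmove, by omega, fun h => absurd h hrx⟩
      · have := sum_add_eq_of_eq_off (S := {x}ᶜ) hr' (by simp [hix])
        exact ⟨c, Or.inl rfl, by omega, fun h => absurd h hrx⟩

/-! ### The pursuers in charge of two coordinates -/

/-- The distance between `c` and `r`, as the sum of the distances in the coordinates `x` and `y`
and in the others. -/
def pairDist (x y : Fin k) (c r : ∀ i, Fin (n i)) : ℕ :=
  ∑ i ∈ {x, y}ᶜ, gap c r i + (gap c r x + gap c r y)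

open Classical in
/-- The measure of a pursuer on `c` who is in charge of the coordinates `x` and `y`. -/
def pairMeasure (x y : Fin k) (c r : ∀ i, Fin (n i)) : WithTop (ℕ ×ₗ ℕ ×ₗ ℕ ×ₗ ℕ) :=
  if Even (pairDist x y c r) then
    (quad (∑ i ∈ {x, y}ᶜ, gap c r i) (gap c r x + gap c r y)
      ((gap c r x - gap c r y) + (gap c r y - gap c r x)) (∑ i, wall c r i) : ℕ ×ₗ ℕ ×ₗ ℕ ×ₗ ℕ)
  else ⊤

theorem pairMeasure_comm (x y : Fin k) (c r : ∀ i, Fin (n i)) :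
    pairMeasure x y c r = pairMeasure y x c r := by
  have : ({x, y} : Finset (Fin k)) = {y, x} := Finset.pair_comm x y
  simp only [pairMeasure, pairDist, this, add_comm]

theorem pairDist_of_eq_off {x y : Fin k} (hxy : x ≠ y) {c c' r r' : ∀ i, Fin (n i)} {i : Fin k}
    (h : ∀ j, j ≠ i → gap c' r' j = gap c r j) :
    pairDist x y c' r' + gap c r i = pairDist x y c r + gap c' r' i := by
  unfold pairDist
  by_cases hx : i = x
  · subst hx
    have h1 := sum_eq_of_eq_off (S := {i, y}ᶜ) h (by simp)
    have h2 := h y hxy.symm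
    omega
  by_cases hy : i = y
  · subst hy
    have h1 := sum_eq_of_eq_off (S := {x, i}ᶜ) h (by simp)
    have h2 := h x hxy
    omega
  have h1 := sum_add_eq_of_eq_off (S := {x, y}ᶜ) h (by simp [hx, hy])
  have h2 := h x (Ne.symm hx)
  have h3 := h y (Ne.symm hy)
  omega

theorem exists_gap_pos_of_pairDist_pos {x y : Fin k} {c r : ∀ i, Fin (n i)}
    (h : 0 < pairDist x y c r) : ∃ i, 0 < gap c r i := by
  by_contra! H
  have H' : ∀ i, gap c r i = 0 := fun i => Nat.le_zero.mp (H i)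
  simp [pairDist, H'] at h

/-- Gaps outside the pair are closed first. After that the pursuer reduces the larger of the two
gaps left by the evader's step, which shrinks their sum or their difference, or else follows the
evader towards a wall. -/
theorem exists_pairMeasure_lt {x y : Fin k} (hxy : x ≠ y) {c r r' : ∀ i, Fin (n i)} (hcr : c ≠ r)
    (hx : (r x).val + 1 = r' x ∨ (r' x).val + 1 = r x) (hr : ∀ j, j ≠ x → r' j = r j)
    (heven : Even (pairDist x y c r)) :
    ∃ c', (cartesianGrid n).IsTokenMove c c' ∧ pairMeasure x y c' r' < pairMeasure x y c r := by
  have hr' : ∀ j, j ≠ x → gap c r' j = gap c r j := fun j hj => gap_congr rfl (hr j hj)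
  have hdist := pairDist_of_eq_off hxy hr'
  have hsum := sum_eq_of_eq_off (S := {x, y}ᶜ) hr' (by simp)
  have hy := hr' y hxy.symm
  have hgap := gap_of_move (c := c) hx
  suffices ∃ c', (cartesianGrid n).IsTokenMove c c' ∧ Even (pairDist x y c' r') ∧
      quad (∑ i ∈ {x, y}ᶜ, gap c' r' i) (gap c' r' x + gap c' r' y)
        ((gap c' r' x - gap c' r' y) + (gap c' r' y - gap c' r' x)) (∑ i, wall c' r' i) <
      quad (∑ i ∈ {x, y}ᶜ, gap c r i) (gap c r x + gap c r y)
        ((gap c r x - gap c r y) + (gap c r y - gap c r x)) (∑ i, wall c r i) by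
    obtain ⟨c', h1, h2, h3⟩ := this
    refine ⟨c', h1, ?_⟩
    rw [pairMeasure, pairMeasure, if_pos h2, if_pos heven]
    exact WithTop.coe_lt_coe.mpr h3
  simp only [quad_lt, Nat.even_iff] at heven ⊢
  rcases Nat.eq_zero_or_pos (∑ i ∈ {x, y}ᶜ, gap c r i) with hE | hE
  · have hpos : 0 < gap c r x + gap c r y := by
      obtain ⟨j, hj⟩ := exists_gap_pos hcr
      by_cases hjx : j = x
      · subst hjx
        omega
      by_cases hjy : j = y
      · subst hjy
        omega
      have := Finset.sum_eq_zero_iff.mp hE j (by simp [hjx, hjy])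
      omega
    have hD : pairDist x y c r = gap c r x + gap c r y := by rw [pairDist, hE, zero_add]
    rcases lt_or_ge (gap c r' x) (gap c r y) with hlt | hge
    · obtain ⟨c', hmove, hc, hg, -⟩ := exists_approach (c := c) (r := r') (i := y) (by omega)
      have h1 : ∀ j, j ≠ y → gap c' r' j = gap c r' j := fun j hj => gap_congr (hc j hj) rfl
      have h2 := pairDist_of_eq_off hxy h1
      have h3 := sum_eq_of_eq_off (S := {x, y}ᶜ) h1 (by simp)
      have h4 := h1 x hxy
      exact ⟨c', hmove, by omega, by omega⟩
    · rcases hgap with hg | hg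
      · obtain ⟨c', hmove, h1, -, hw⟩ := exists_follow hx hr hg
        -- By parity `gap c r x ≥ gap c r y`, and the sum is positive, so the evader really flees in
        -- `x`; at odd distance `gap c r x` could be `0`.
        have := hw (by omega)
        have h2 := pairDist_of_eq_off hxy (i := x) fun j _ => h1 j
        have h3 := h1 x
        have h4 := h1 y
        have h5 := sum_gap_congr h1 {x, y}ᶜ
        exact ⟨c', hmove, by omega, by omega⟩
      · obtain ⟨c', hmove, hc, hg', -⟩ := exists_approach (c := c) (r := r') (i := x) (by omega)
        have h1 : ∀ j, j ≠ x → gap c' r' j = gap c r' j := fun j hj => gap_congr (hc j hj) rfl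
        have h2 := pairDist_of_eq_off hxy h1
        have h3 := sum_eq_of_eq_off (S := {x, y}ᶜ) h1 (by simp)
        have h4 := h1 y hxy.symm
        exact ⟨c', hmove, by omega, by omega⟩
  · obtain ⟨l, hl, hpos⟩ := exists_gap_pos_of_sum_pos (hsum ▸ hE)
    obtain ⟨c', hmove, hc, hg, -⟩ := exists_approach hpos
    have h1 : ∀ j, j ≠ l → gap c' r' j = gap c r' j := fun j hj => gap_congr (hc j hj) rfl
    have h2 := pairDist_of_eq_off hxy h1
    have h3 := sum_add_eq_of_eq_off h1 hl
    exact ⟨c', hmove, by omega, by omega⟩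

theorem exists_pairMeasure_le {x y : Fin k} (hxy : x ≠ y) {c r r' : ∀ i, Fin (n i)} (hcr : c ≠ r)
    (h : (cartesianGrid n).IsTokenMove r r') :
    ∃ c', (cartesianGrid n).IsTokenMove c c' ∧ pairMeasure x y c' r' ≤ pairMeasure x y c r ∧
      (r x ≠ r' x ∨ r y ≠ r' y → pairMeasure x y c' r' < pairMeasure x y c r) := by
  by_cases heven : Even (pairDist x y c r)
  swap
  -- Odd parity is repaired at once: by waiting if the evader moved, by approaching if he passed.
  · have htop : pairMeasure x y c r = ⊤ := if_neg heven
    suffices ∃ c', (cartesianGrid n).IsTokenMove c c' ∧ Even (pairDist x y c' r') by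
      obtain ⟨c', h1, h2⟩ := this
      have : pairMeasure x y c' r' < ⊤ := by
        rw [pairMeasure, if_pos h2]
        exact WithTop.coe_lt_top _
      exact ⟨c', h1, htop ▸ le_top, fun _ => htop ▸ this⟩
    by_cases he : Even (pairDist x y c r')
    · exact ⟨c, Or.inl rfl, he⟩
    · rw [Nat.even_iff] at he
      obtain ⟨l, hl⟩ := exists_gap_pos_of_pairDist_pos (x := x) (y := y) (c := c) (r := r')
        (by omega)
      obtain ⟨c', hmove, hc, hg, -⟩ := exists_approach hl
      have := pairDist_of_eq_off hxy (c := c) (r := r') (c' := c') (r' := r')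
        fun j hj => gap_congr (hc j hj) rfl
      refine ⟨c', hmove, ?_⟩
      rw [Nat.even_iff]
      omega
  rcases cartesianGrid_isTokenMove_cases h with rfl | ⟨i, hi, hr⟩
  · exact ⟨c, Or.inl rfl, le_rfl, by simp⟩
  by_cases hix : i = x
  · subst hix
    obtain ⟨c', h1, h2⟩ := exists_pairMeasure_lt hxy hcr hi hr heven
    exact ⟨c', h1, h2.le, fun _ => h2⟩
  by_cases hiy : i = y
  · subst hiy
    have heven' : Even (pairDist i x c r) := by
      rwa [pairDist, Finset.pair_comm, add_comm (gap c r i)]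
    obtain ⟨c', h1, h2⟩ := exists_pairMeasure_lt hxy.symm hcr hi hr heven'
    rw [pairMeasure_comm, pairMeasure_comm i x c r] at h2
    exact ⟨c', h1, h2.le, fun _ => h2⟩
  have hnot : ¬ (r x ≠ r' x ∨ r y ≠ r' y) := by
    simp [hr x (Ne.symm hix), hr y (Ne.symm hiy)]
  have hr' : ∀ j, j ≠ i → gap c r' j = gap c r j := fun j hj => gap_congr rfl (hr j hj)
  suffices ∃ c', (cartesianGrid n).IsTokenMove c c' ∧ Even (pairDist x y c' r') ∧
      quad (∑ i ∈ {x, y}ᶜ, gap c' r' i) (gap c' r' x + gap c' r' y)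
        ((gap c' r' x - gap c' r' y) + (gap c' r' y - gap c' r' x)) (∑ i, wall c' r' i) ≤
      quad (∑ i ∈ {x, y}ᶜ, gap c r i) (gap c r x + gap c r y)
        ((gap c r x - gap c r y) + (gap c r y - gap c r x)) (∑ i, wall c r i) by
    obtain ⟨c', h1, h2, h3⟩ := this
    refine ⟨c', h1, ?_, fun h => absurd h hnot⟩
    rw [pairMeasure, pairMeasure, if_pos h2, if_pos heven]
    exact WithTop.coe_le_coe.mpr h3
  simp only [quad_le, Nat.even_iff] at heven ⊢
  have himem : i ∈ ({x, y}ᶜ : Finset (Fin k)) := by simp [hix, hiy]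
  rcases gap_of_move (c := c) hi with hg | hg
  · obtain ⟨c', hmove, h1, hw, -⟩ := exists_follow hi hr hg
    refine ⟨c', hmove, ?_, ?_⟩
    · simpa only [pairDist, h1] using heven
    · have h2 := sum_gap_congr h1 {x, y}ᶜ
      have h3 := h1 x
      have h4 := h1 y
      omega
  · have hdist := pairDist_of_eq_off hxy hr'
    have hsum := sum_add_eq_of_eq_off hr' himem
    -- The evader's step made the distance odd, hence positive, so some approaching step exists and
    -- restores parity.
    obtain ⟨l, hl⟩ := exists_gap_pos_of_pairDist_pos (x := x) (y := y) (c := c) (r := r')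
      (by omega)
    obtain ⟨c', hmove, hc, hg', -⟩ := exists_approach hl
    have h1 : ∀ j, j ≠ l → gap c' r' j = gap c r' j := fun j hj => gap_congr (hc j hj) rfl
    have h2 := pairDist_of_eq_off hxy h1
    have h3 : ∑ j ∈ {x, y}ᶜ, gap c' r' j ≤ ∑ j ∈ {x, y}ᶜ, gap c r' j :=
      Finset.sum_le_sum fun j _ => by
        by_cases hj : j = l
        · subst hj
          omega
        · exact (h1 j hj).le
    exact ⟨c', hmove, by omega, by omega⟩

/-! ### Sharing the coordinates among the pursuers -/

/-- On a grid of dimension `k`, an evader is caught by `k / 2 + 1` pursuers. -/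
theorem exists_isPursuit_cartesianGrid (n : Fin k → ℕ) :
    ∃ μ : Fin (k / 2 + 1) → (∀ i, Fin (n i)) → (∀ i, Fin (n i)) →
      WithTop (ℕ ×ₗ ℕ ×ₗ ℕ ×ₗ ℕ), (cartesianGrid n).IsPursuit μ := by
  rcases Nat.eq_zero_or_pos k with rfl | hk
  · exact ⟨fun _ _ _ => ⊤, fun c r _ _ h => absurd (Subsingleton.elim _ _) (h 0)⟩
  -- Pursuer `j ≥ 1` gets the pair `2j - 1, 2j`. For even `k` the last pair wraps around to `k - 1,
  -- 0`, so that coordinate `0` is harmlessly covered twice.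
  let x : Fin (k / 2 + 1) → Fin k := fun j => ⟨(2 * j.val - 1) % k, Nat.mod_lt _ hk⟩
  let y : Fin (k / 2 + 1) → Fin k := fun j => ⟨2 * j.val % k, Nat.mod_lt _ hk⟩
  have hx : ∀ j, (x j).val = 2 * j.val - 1 := fun j => Nat.mod_eq_of_lt (by omega)
  have hy : ∀ j, (y j).val = if 2 * j.val = k then 0 else 2 * j.val := fun j => by
    split_ifs with h
    · simp [y, h]
    · exact Nat.mod_eq_of_lt (by omega)
  have hxy : ∀ j : Fin (k / 2 + 1), j ≠ 0 → x j ≠ y j := fun j hj h => by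
    have h1 := congrArg Fin.val h
    have h2 : j.val ≠ 0 := fun h => hj (Fin.ext h)
    rw [hx, hy] at h1
    split_ifs at h1 <;> omega
  refine ⟨fun j => if j = 0 then axisMeasure ⟨0, hk⟩ else pairMeasure (x j) (y j),
    fun c r r' h hne => ?_⟩
  have key : ∀ j, ∃ c', (cartesianGrid n).IsTokenMove (c j) c' ∧
      (if j = 0 then axisMeasure ⟨0, hk⟩ else pairMeasure (x j) (y j)) c' r' ≤
        (if j = 0 then axisMeasure ⟨0, hk⟩ else pairMeasure (x j) (y j)) (c j) r ∧
      ((if j = 0 then r = r' ∨ r ⟨0, hk⟩ ≠ r' ⟨0, hk⟩ else r (x j) ≠ r' (x j) ∨ r (y j) ≠ r' (y j)) →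
        (if j = 0 then axisMeasure ⟨0, hk⟩ else pairMeasure (x j) (y j)) c' r' <
          (if j = 0 then axisMeasure ⟨0, hk⟩ else pairMeasure (x j) (y j)) (c j) r) := by
    intro j
    by_cases hj : j = 0
    · simpa only [hj, if_true] using exists_axisMeasure_le ⟨0, hk⟩ (hne 0) h
    · simpa only [hj, if_false] using exists_pairMeasure_le (hxy j hj) (hne j) h
  choose c' hmove hle hlt using key
  refine ⟨c', hmove, Pi.lt_def.mpr ⟨hle, ?_⟩⟩
  rcases cartesianGrid_isTokenMove_cases h with heq | ⟨i, hi, -⟩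
  · exact ⟨0, hlt 0 (by simp [heq])⟩
  have hri : r i ≠ r' i := fun h => by
    rw [h] at hi
    omega
  by_cases hi0 : i.val = 0
  · obtain rfl : i = ⟨0, hk⟩ := Fin.ext hi0
    exact ⟨0, hlt 0 (by simp [hri])⟩
  have hj : (i.val + 1) / 2 < k / 2 + 1 := by omega
  have hj0 : (⟨(i.val + 1) / 2, hj⟩ : Fin (k / 2 + 1)) ≠ 0 := fun h => by
    have := congrArg Fin.val h
    simp only [Fin.val_zero] at this
    omega
  refine ⟨⟨(i.val + 1) / 2, hj⟩, hlt _ ?_⟩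
  rw [if_neg hj0]
  rcases Nat.mod_two_eq_zero_or_one i.val with hmod | hmod
  · right
    have : y ⟨(i.val + 1) / 2, hj⟩ = i := Fin.ext (by
      rw [hy]
      simp only
      split_ifs <;> omega)
    rwa [this]
  · left
    have : x ⟨(i.val + 1) / 2, hj⟩ = i := Fin.ext (by
      rw [hx]
      simp only
      omega)
    rwa [this]

/-! ### Shifts of the grid and the final count -/

/-- The next vertex of the path on `m` vertices, in one of the two directions, if there is one. -/
def pathShift {m : ℕ} (up : Prop) [Decidable up] (v : Fin m) : Fin m :=
  if up then (if h : v.val + 1 < m then ⟨v + 1, h⟩ else v) else ⟨v - 1, by omega⟩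

theorem pathShift_adj {m : ℕ} (up : Prop) [Decidable up] {v w : Fin m}
    (h : v.val + 1 = w ∨ w.val + 1 = v) :
    pathShift up v = pathShift up w ∨ (pathShift up v).val + 1 = pathShift up w ∨
      (pathShift up w).val + 1 = pathShift up v := by
  rw [Fin.ext_iff]
  unfold pathShift
  split_ifs <;> (try dsimp only) <;> omega

/-- The vertex next to `v` in direction `i / 2` of the grid, upwards for even `i` and downwards for
odd `i`, if there is one. -/
def gridShift (n : Fin k → ℕ) (i : ℕ) (v : ∀ i, Fin (n i)) : ∀ i, Fin (n i) := fun j =>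
  if j.val = i / 2 then pathShift (i % 2 = 0) (v j) else v j

theorem gridShift_isTokenMove (i : ℕ) (v w : ∀ i, Fin (n i))
    (h : (cartesianGrid n).IsTokenMove v w) :
    (cartesianGrid n).IsTokenMove (gridShift n i v) (gridShift n i w) := by
  rcases cartesianGrid_isTokenMove_cases h with rfl | ⟨l, hl, hw⟩
  · exact Or.inl rfl
  have : gridShift n i w = Function.update (gridShift n i v) l (gridShift n i w l) := by
    funext j
    by_cases hj : j = l
    · subst hj
      simp
    · simp [gridShift, hj, hw j hj]
  rw [this]
  apply cartesianGrid_isTokenMove_update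
  unfold gridShift
  split_ifs
  · exact pathShift_adj _ hl
  · exact Or.inr hl

theorem exists_gridShift_eq {v w : ∀ i, Fin (n i)} (h : (cartesianGrid n).Adj v w) :
    ∃ i < 2 * k, gridShift n i v = w := by
  obtain ⟨l, hl, hw⟩ := h
  have hlk := l.isLt
  have hlt := (w l).isLt
  rcases pathGraph_adj.mp hl with hl | hl
  · refine ⟨2 * l, by omega, funext fun j => ?_⟩
    by_cases hj : j = l
    · subst hj
      ext
      simp [gridShift, pathShift]
      split_ifs <;> omega
    · have : j.val ≠ l := fun h => hj (Fin.ext h)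
      simp [gridShift, this, hw j hj]
  · have hdiv : (2 * l.val + 1) / 2 = l := by omega
    have hmod : (2 * l.val + 1) % 2 ≠ 0 := by omega
    refine ⟨2 * l + 1, by omega, funext fun j => ?_⟩
    by_cases hj : j = l
    · subst hj
      ext
      simp only [gridShift, pathShift, hdiv, if_true, if_neg hmod]
      omega
    · have : j.val ≠ l := fun h => hj (Fin.ext h)
      simp [gridShift, hdiv, this, hw j hj]

theorem cartesianGrid_bodyguardsWin (hn : ∀ i, 0 < n i) :
    (cartesianGrid n).BodyguardsWin (2 * k + k / 2) := by
  obtain ⟨μ, hμ⟩ := exists_isPursuit_cartesianGrid n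
  have : Nonempty (∀ i, Fin (n i)) := ⟨fun i => ⟨0, hn i⟩⟩
  exact bodyguardsWin_of_isPursuit hμ (gridShift n) gridShift_isTokenMove
    fun _ _ => exists_gridShift_eq

end Grid

end SimpleGraph

theorem mainTheorem10 (k : ℕ) (n : Fin k → ℕ) (hn : ∀ i, 2 ≤ n i) :
    (SimpleGraph.cartesianGrid n).bodyguardNumber ≤ ((5 * k / 2 : ℕ) : ℕ∞) := by
  have h := SimpleGraph.cartesianGrid_bodyguardsWin fun i => zero_lt_two.trans_le (hn i)
  rw [show 2 * k + k / 2 = 5 * k / 2 by omega] at h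
  exact iInf_le (fun b : {b : ℕ // (SimpleGraph.cartesianGrid n).BodyguardsWin b} =>
    ((b : ℕ) : ℕ∞)) ⟨_, h⟩
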